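/- Let $0\le q\le 1$ and $0\le p\le 1$, let $S_1,S_2,\dots$ be i.i.d. Bernoulli$(q)$, and for binary words $s,\hat s\in\{0,1\}^N$ put $d(s_i,\hat s_i)=\mathbf 1\{s_i>\hat s_i\}$, $d_N(s,\hat s)=\frac1N\sum_{i=1}^N d(s_i,\hat s_i)$ and $w(\hat s)=\frac1N\sum_{i=1}^N\hat s_i$. A code of block length $N$ with $M$ codewords is a pair of maps $\{0,1\}^N\to\{1,\dots,M\}\to\{0,1\}^N$ (encoder, decoder); $\hat{\mathbf S}$ is the reconstruction of $\mathbf S=(S_1,\dots,S_N)$. For real $R,D$ call $(R,D)$ achievable under a weight constraint if there are codes of all block lengths $N$, with at most $2^{NR}$ codewords each and all satisfying the constraint, such that $\limsup_{N\to\infty}\mathbb E\,d_N(\mathbf S,\hat{\mathbf S})\le D$. Let $R(D)$ be the infimum of the $R$ such that $(R,D)$ is achievable under the constraint that $w(\hat s)\le p$ for every codeword $\hat s$ (with $\inf\emptyset=+\infty$). Then for every real $D$ $$R(D)=\min_{P_{\hat S|S}:\ \mathbb E\,d(S,\hat S)\le D,\ \mathbb P\{\hat S=1\}\le p} I(S;\hat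 S),$$ where $S\sim$ Bernoulli$(q)$, $\hat S$ is binary and $I$ is the mutual information in bits. The set of feasible $P_{\hat S|S}$ is nonempty if and only if $D\ge\max\{q-p,0\}$; in this case the minimum is attained, and otherwise both sides are $+\infty$. The same formula holds if the constraint on every codeword is replaced by the average constraint $\mathbb E\,w(\hat{\mathbf S})\le p$. Moreover the converse holds at every block length $N\ge1$: every code with $M$ codewords, $\mathbb E\,w(\hat{\mathbf S})\le p$ and $\mathbb E\,d_N(\mathbf S,\hat{\mathbf S})\le D$ has rate $\frac1N\log_2 M$ at least the above minimum. -/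

import Mathlib

open Finset

/-- Probability mass function of a Bernoulli(`q`) bit; `true` stands for `1`, `false` for `0`. -/
noncomputable def bernoulliMass (q : ℝ) (s : Bool) : ℝ := if s then q else 1 - q

/-- Law of the first `N` letters of an i.i.d. Bernoulli(`q`) source. -/
noncomputable def sourceMass (q : ℝ) {N : ℕ} (s : Fin N → Bool) : ℝ :=
  ∏ i, bernoulliMass q (s i)

/-- Single-letter distortion `d(s, t) = 1{s > t}` (with `false < true`). -/
noncomputable def distortion (s t : Bool) : ℝ := if t < s then 1 else 0

/-- Distortion of a block: the average of the single-letter distortions. -/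
noncomputable def blockDistortion {N : ℕ} (s t : Fin N → Bool) : ℝ :=
  (1 / (N : ℝ)) * ∑ i, distortion (s i) (t i)

/-- Normalized Hamming weight of a binary word. -/
noncomputable def weight {N : ℕ} (t : Fin N → Bool) : ℝ :=
  (1 / (N : ℝ)) * ∑ i, (if t i then (1 : ℝ) else 0)

/-- A source code of block length `N` with `M` codewords: an encoder and a decoder. -/
structure SourceCode (N M : ℕ) where
  enc : (Fin N → Bool) → Fin M
  dec : Fin M → (Fin N → Bool)

namespace SourceCode

variable {N M : ℕ}

/-- The reconstruction of the source word `s`. -/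
def reconstruct (c : SourceCode N M) (s : Fin N → Bool) : Fin N → Bool := c.dec (c.enc s)

/-- Expected block distortion of the code for the Bernoulli(`q`) source. -/
noncomputable def expDistortion (q : ℝ) (c : SourceCode N M) : ℝ :=
  ∑ s, sourceMass q s * blockDistortion s (c.reconstruct s)

/-- Expected normalized weight of the reconstruction for the Bernoulli(`q`) source. -/
noncomputable def expWeight (q : ℝ) (c : SourceCode N M) : ℝ :=
  ∑ s, sourceMass q s * weight (c.reconstruct s)

/-- Every codeword has normalized weight at most `p`. -/
def EveryWeightLE (p : ℝ) (c : SourceCode N M) : Prop := ∀ m, weight (c.dec m) ≤ p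

/-- The expected normalized weight of the reconstruction is at most `p`. -/
def AverageWeightLE (q p : ℝ) (c : SourceCode N M) : Prop := c.expWeight q ≤ p

end SourceCode

/-- `(R, D)` is achievable by codes satisfying the constraint `C`: there is a sequence of codes,
one for each block length `N`, having at most `2 ^ (N R)` codewords, all of which satisfy `C`, and
whose expected distortions have limit superior at most `D`. -/
def Achievable (q : ℝ) (C : ∀ {N M : ℕ}, SourceCode N M → Prop) (R D : ℝ) : Prop :=
  ∃ (M : ℕ → ℕ) (c : ∀ N, SourceCode N (M N)),
    (∀ N : ℕ, (M N : ℝ) ≤ (2 : ℝ) ^ ((N : ℝ) * R)) ∧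
    (∀ N, C (c N)) ∧
    ∀ ε > 0, ∀ᶠ N in Filter.atTop, (c N).expDistortion q ≤ D + ε

/-- Operational rate-distortion function under the constraint that every reconstruction has
normalized weight at most `p`: the infimum of the rates `R` for which `(R, D)` is achievable
(`⊤` if there are none). -/
noncomputable def rateDistortion (q p D : ℝ) : EReal :=
  sInf {x | ∃ R : ℝ, Achievable q (fun c => c.EveryWeightLE p) R D ∧ x = (R : EReal)}

/-- Operational rate-distortion function under the constraint that the reconstruction has
expected normalized weight at most `p`. -/
noncomputable def rateDistortionAvg (q p D : ℝ) : EReal :=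
  sInf {x | ∃ R : ℝ, Achievable q (fun c => c.AverageWeightLE q p) R D ∧ x = (R : EReal)}

/-- Mutual information, in bits, of two random variables with joint mass function `P` on a
product of finite alphabets. Terms with `P a b = 0` vanish. -/
noncomputable def mutualInformation {α β : Type*} [Fintype α] [Fintype β]
    (P : α → β → ℝ) : ℝ :=
  ∑ a, ∑ b, P a b * Real.logb 2 (P a b / ((∑ b', P a b') * (∑ a', P a' b)))

/-- Joint mass function of `(S, Ŝ)` for `S` Bernoulli(`q`) and conditional law
`W s t = P(Ŝ = t | S = s)`. -/
noncomputable def jointMass (q : ℝ) (W : Bool → Bool → ℝ) (s t : Bool) : ℝ :=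
  bernoulliMass q s * W s t

/-- The information `I(S; Ŝ)` in bits, for `S` Bernoulli(`q`) and conditional law `W`. -/
noncomputable def channelInformation (q : ℝ) (W : Bool → Bool → ℝ) : ℝ :=
  mutualInformation (jointMass q W)

/-- The conditional laws `W s t = P(Ŝ = t | S = s)` with `E d(S, Ŝ) ≤ D` and `P(Ŝ = 1) ≤ p`. -/
def feasibleChannels (q p D : ℝ) : Set (Bool → Bool → ℝ) :=
  {W | (∀ s t, 0 ≤ W s t) ∧ (∀ s, ∑ t, W s t = 1) ∧
    ∑ s, ∑ t, jointMass q W s t * distortion s t ≤ D ∧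
    ∑ s, jointMass q W s true ≤ p}

/-- The single-letter expression: the infimum of `I(S; Ŝ)` over the feasible conditional laws
(`⊤` if there are none). -/
noncomputable def singleLetterRate (q p D : ℝ) : EReal :=
  sInf {x | ∃ W ∈ feasibleChannels q p D, x = (channelInformation q W : EReal)}

/-!
The operational rate equals the single-letter expression because of two bounds.

Converse. A code of block length `N` with `M` codewords induces a channel, the conditional law of
`(S_I, Ŝ_I)` at a uniformly chosen coordinate `I`. Distortion and weight are averages over
coordinates, so this channel satisfies the same constraints as the code (`averageChannel_mem`).
Let `r` be its joint law divided by the product of its marginals. Then `N` times its information is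
`E log ∏ r (S_i, Ŝ_i)`. By `log (x / M) ≤ x / M - 1` and a union bound over the codewords, this is at
most `log M`, because `E ∏ r (S_i, t_i) ≤ 1` for every fixed word `t`
(`channelInformation_averageChannel_le`). This argument replaces the usual chain of entropy
inequalities and the convexity of information. Compactness of the feasible channels removes the
slack in the limit superior of the distortions (`exists_feasible_of_achievable`).

Direct part. Given a channel of information below `R` that meets the constraints strictly, draw
about `2 ^ (N R)` codewords from the product of its output law. Chernoff's bound
(`tendsto_upper_tail`) and the covering lemma (`exists_covering`) show that all source words but a
set of vanishing probability have a codeword with information density, distortion and weight within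
the bounds (`eventually_exists_code`). Mixing with the all-zero channel makes the weight bound
strict when `p > 0`; for `p = 0` the zero code is enough (`achievable_of_feasible`).

The minimum is attained since the feasible set is compact and information, a combination of
entropies, is continuous on it.
-/

/-! ### Sums over product spaces and an exponential tail bound -/

theorem sum_pi_prod {ι κ : Type*} [Fintype ι] [DecidableEq ι] [Fintype κ] (f : ι → κ → ℝ) :
    ∑ x : ι → κ, ∏ i, f i (x i) = ∏ i, ∑ a, f i a := by
  rw [Finset.prod_univ_sum, Fintype.piFinset_univ]

/-- If the mean of `f` is below `c`, the exponential moment of `f - c` drops below `1` for some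
small positive parameter, because its derivative at `0` is the mean of `f - c`. -/
theorem exists_exp_moment_lt_one {α : Type*} [Fintype α] (μ f : α → ℝ) (c : ℝ)
    (h1 : ∑ a, μ a = 1) (hc : ∑ a, μ a * f a < c) :
    ∃ l > 0, ∑ a, μ a * Real.exp (l * (f a - c)) < 1 := by
  have hd : HasDerivAt (fun l : ℝ => ∑ a, μ a * Real.exp (l * (f a - c)))
      (∑ a, μ a * (f a - c)) 0 := by
    have : ∀ a ∈ (univ : Finset α), HasDerivAt (fun l : ℝ => μ a * Real.exp (l * (f a - c)))
        (μ a * (f a - c)) 0 := by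
      intro a _
      have := (((hasDerivAt_id (0 : ℝ)).mul_const (f a - c)).exp).const_mul (μ a)
      simpa using this
    exact HasDerivAt.fun_sum this
  have hneg : ∑ a, μ a * (f a - c) < 0 := by
    simp only [mul_sub, sum_sub_distrib, ← sum_mul, h1]
    linarith
  have hs := ((hasDerivAt_iff_tendsto_slope.1 hd).mono_left
    (nhdsWithin_mono 0 (fun x (hx : x ∈ Set.Ioi (0 : ℝ)) => ne_of_gt hx))).eventually_lt_const hneg
  obtain ⟨l, hl, hl0⟩ := (hs.and self_mem_nhdsWithin).exists
  refine ⟨l, hl0, ?_⟩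
  have hl0' : 0 < l := hl0
  rw [slope_def_field, div_lt_iff₀ (by linarith)] at hl
  simp only [zero_mul, Real.exp_zero, mul_one, h1] at hl
  linarith

/-- One-sided weak law of large numbers, by Chernoff's bound. The random codes only need to be good
in three one-sided ways (information, distortion, weight), so no two-sided statement is needed. -/
theorem tendsto_upper_tail {α : Type*} [Fintype α] (μ f : α → ℝ) (c : ℝ)
    (h0 : ∀ a, 0 ≤ μ a) (h1 : ∑ a, μ a = 1) (hc : ∑ a, μ a * f a < c) :
    Filter.Tendsto (fun N : ℕ => ∑ x : Fin N → α,
      (∏ i, μ (x i)) * (if N * c ≤ ∑ i, f (x i) then 1 else 0)) Filter.atTop (nhds 0) := by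
  obtain ⟨l, hl0, hl⟩ := exists_exp_moment_lt_one μ f c h1 hc
  have hφ0 : 0 ≤ ∑ a, μ a * Real.exp (l * (f a - c)) :=
    sum_nonneg fun a _ => mul_nonneg (h0 a) (Real.exp_nonneg _)
  refine squeeze_zero (fun N => sum_nonneg fun x _ => mul_nonneg (prod_nonneg fun i _ => h0 _)
    (by split_ifs <;> norm_num)) (fun N => ?_) (tendsto_pow_atTop_nhds_zero_of_lt_one hφ0 hl)
  calc _ ≤ ∑ x : Fin N → α, ∏ i, (μ (x i) * Real.exp (l * (f (x i) - c))) := by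
        refine sum_le_sum fun x _ => ?_
        rw [prod_mul_distrib, ← Real.exp_sum, ← mul_sum, sum_sub_distrib]
        refine mul_le_mul_of_nonneg_left ?_ (prod_nonneg fun i _ => h0 _)
        split_ifs with h
        · refine Real.one_le_exp (mul_nonneg hl0.le ?_)
          simpa using h
        · exact Real.exp_nonneg _
    _ = _ := by
        rw [sum_pi_prod (fun (_ : Fin N) a => μ a * Real.exp (l * (f a - c)))]
        simp

/-! ### Random covering -/

theorem one_sub_mul_pow_le {x y : ℝ} (hx0 : 0 ≤ x) (hx1 : x ≤ 1) (hxy : x * y ≤ 1)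
    (M : ℕ) : (1 - x * y) ^ M ≤ 1 - x + Real.exp (-(M * y)) := by
  have h1 : (1 - x * y) ^ M ≤ Real.exp (-(x * y)) ^ M :=
    pow_le_pow_left₀ (by linarith) (by linarith [Real.add_one_le_exp (-(x * y))]) M
  have h2 := convexOn_exp.2 (Set.mem_univ 0) (Set.mem_univ (-(M * y)))
    (sub_nonneg.2 hx1) hx0 (by ring)
  simp only [smul_eq_mul, mul_zero, zero_add, Real.exp_zero, mul_one] at h2
  have h3 : Real.exp (-(x * y)) ^ M = Real.exp (x * -(M * y)) := by
    rw [← Real.exp_nat_mul]; congr 1; ring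
  nlinarith [Real.exp_nonneg (-(M * y))]

open Classical in
/-- Random covering lemma. Draw `M` words independently from `Q`. If `Q t ≥ y * V s t` on good
pairs, a source letter `s` is left without a good word with probability at most
`(1 - y * V s (good))ᴹ ≤ V s (bad) + exp (-M y)`. Some codebook does at least as well as the
average. -/
theorem exists_covering {S T : Type*} [Fintype S] [Fintype T] (π : S → ℝ) (Q : T → ℝ)
    (V : S → T → ℝ) (G : S → T → Prop) (y : ℝ) (M : ℕ)
    (hπ0 : ∀ s, 0 ≤ π s) (hπ1 : ∑ s, π s = 1) (hQ0 : ∀ t, 0 ≤ Q t) (hQ1 : ∑ t, Q t = 1)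
    (hV0 : ∀ s t, 0 ≤ V s t) (hV1 : ∀ s, ∑ t, V s t = 1)
    (hG : ∀ s t, π s ≠ 0 → G s t → y * V s t ≤ Q t) :
    ∃ C : Fin M → T, ∑ s, π s * (if ∃ m, G s (C m) then 0 else 1) ≤
      ∑ s, ∑ t, π s * V s t * (if G s t then 0 else 1) + Real.exp (-(M * y)) := by
  have key : ∑ C : Fin M → T, (∏ m, Q (C m)) *
      (∑ s, π s * (if ∃ m, G s (C m) then (0 : ℝ) else 1)) ≤
      ∑ s, ∑ t, π s * V s t * (if G s t then 0 else 1) + Real.exp (-(M * y)) := by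
    have e1 : ∑ C : Fin M → T, (∏ m, Q (C m)) *
      (∑ s, π s * (if ∃ m, G s (C m) then (0 : ℝ) else 1)) =
        ∑ s, π s * (∑ t, Q t * (if G s t then 0 else 1)) ^ M := by
      simp_rw [mul_sum]
      rw [sum_comm]
      refine sum_congr rfl fun s _ => ?_
      have : ∀ C : Fin M → T, (∏ m, Q (C m)) * (π s * (if ∃ m, G s (C m) then (0 : ℝ) else 1)) =
          π s * ∏ m, (Q (C m) * (if G s (C m) then 0 else 1)) := by
        intro C
        rw [prod_mul_distrib]
        have : (if ∃ m, G s (C m) then (0 : ℝ) else 1) = ∏ m, (if G s (C m) then (0 : ℝ) else 1) := by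
          split_ifs with h
          · obtain ⟨m, hm⟩ := h
            exact (prod_eq_zero (mem_univ m) (by simp [hm])).symm
          · push Not at h
            exact (prod_eq_one fun m _ => by simp [h m]).symm
        rw [this]; ring
      rw [sum_congr rfl fun C _ => this C, ← mul_sum,
        sum_pi_prod (fun (_ : Fin M) t => Q t * (if G s t then (0 : ℝ) else 1))]
      simp
    rw [e1]
    have e2 : ∀ s, π s * (∑ t, Q t * (if G s t then 0 else 1)) ^ M ≤
        ∑ t, π s * V s t * (if G s t then 0 else 1) + π s * Real.exp (-(M * y)) := by
      intro s
      by_cases hs : π s = 0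
      · simp [hs]
      -- `x` is the probability of a good pair given `s`.
      set x := ∑ t, V s t * (if G s t then 1 else 0) with hx
      have hflip : ∀ F : T → ℝ, ∑ t, F t = 1 → ∑ t, F t * (if G s t then 0 else 1) =
          1 - ∑ t, F t * (if G s t then 1 else 0) := by
        intro F hF
        rw [eq_sub_iff_add_eq, ← sum_add_distrib]
        refine (sum_congr rfl fun t _ => ?_).trans hF
        split_ifs <;> simp
      have hx0 : 0 ≤ x := sum_nonneg fun t _ => mul_nonneg (hV0 s t) (by split_ifs <;> norm_num)
      have hx1 : 0 ≤ 1 - x := by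
        rw [hx, ← hflip _ (hV1 s)]
        exact sum_nonneg fun t _ => mul_nonneg (hV0 s t) (by split_ifs <;> norm_num)
      have hq0 : 0 ≤ ∑ t, Q t * (if G s t then (0 : ℝ) else 1) :=
        sum_nonneg fun t _ => mul_nonneg (hQ0 t) (by split_ifs <;> norm_num)
      have hxy : x * y ≤ ∑ t, Q t * (if G s t then 1 else 0) := by
        rw [hx, sum_mul]
        refine sum_le_sum fun t _ => ?_
        split_ifs with h
        · linarith [hG s t hs h]
        · simp
      have hb : (∑ t, Q t * (if G s t then (0 : ℝ) else 1)) ≤ 1 - x * y := by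
        rw [hflip Q hQ1]; linarith
      have := (pow_le_pow_left₀ hq0 hb M).trans
        (one_sub_mul_pow_le hx0 (by linarith) (by linarith) M)
      have h3 : ∑ t, π s * V s t * (if G s t then 0 else 1) = π s * (1 - x) := by
        rw [hx, ← hflip _ (hV1 s), mul_sum]
        exact sum_congr rfl fun t _ => by ring
      rw [h3, ← mul_add]
      exact mul_le_mul_of_nonneg_left this (hπ0 s)
    refine (sum_le_sum fun s _ => e2 s).trans ?_
    rw [sum_add_distrib, ← sum_mul, hπ1, one_mul]
  have hw : ∑ C : Fin M → T, ∏ m, Q (C m) = 1 := by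
    rw [sum_pi_prod (fun (_ : Fin M) t => Q t)]; simp [hQ1]
  by_contra! hcon
  have hpos : ∃ C : Fin M → T, 0 < ∏ m, Q (C m) := by
    by_contra! hn
    linarith [sum_nonpos fun C (_ : C ∈ (univ : Finset (Fin M → T))) => hn C]
  obtain ⟨C₀, hC₀⟩ := hpos
  refine absurd key (not_le.2 ?_)
  calc _ = ∑ C : Fin M → T, (∏ m, Q (C m)) *
        (∑ s, ∑ t, π s * V s t * (if G s t then 0 else 1) + Real.exp (-(M * y))) := by
        rw [← sum_mul, hw, one_mul]
    _ < _ := sum_lt_sum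
        (fun C _ => mul_le_mul_of_nonneg_left (hcon C).le (prod_nonneg fun m _ => hQ0 _))
        ⟨C₀, mem_univ _, mul_lt_mul_of_pos_left (hcon C₀) hC₀⟩

/-! ### The Bernoulli source -/

theorem bernoulliMass_nonneg {q : ℝ} (hq0 : 0 ≤ q) (hq1 : q ≤ 1) (a : Bool) :
    0 ≤ bernoulliMass q a := by
  cases a <;> simp [bernoulliMass, hq0, hq1]

theorem sum_bernoulliMass (q : ℝ) : ∑ a, bernoulliMass q a = 1 := by
  simp [bernoulliMass]

theorem sourceMass_nonneg {q : ℝ} (hq0 : 0 ≤ q) (hq1 : q ≤ 1) {N : ℕ} (s : Fin N → Bool) :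
    0 ≤ sourceMass q s :=
  prod_nonneg fun _ _ => bernoulliMass_nonneg hq0 hq1 _

theorem sum_sourceMass (q : ℝ) (N : ℕ) : ∑ s : Fin N → Bool, sourceMass q s = 1 := by
  unfold sourceMass
  rw [sum_pi_prod (fun (_ : Fin N) a => bernoulliMass q a)]
  simp only [sum_bernoulliMass, prod_const_one]

theorem sum_sourceMass_coord (q : ℝ) {N : ℕ} (i : Fin N) (g : Bool → ℝ) :
    ∑ s : Fin N → Bool, sourceMass q s * g (s i) = ∑ a, bernoulliMass q a * g a := by
  have : ∀ s : Fin N → Bool, sourceMass q s * g (s i) =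
      ∏ j, (bernoulliMass q (s j) * if j = i then g (s j) else 1) := by
    intro s
    rw [prod_mul_distrib, sourceMass]
    simp
  rw [sum_congr rfl fun s _ => this s,
    sum_pi_prod (fun j a => bernoulliMass q a * if j = i then g a else 1),
    prod_eq_single i]
  · simp
  · intro j _ hj
    simp only [hj, if_false, mul_one, sum_bernoulliMass]
  · simp

/-! ### Likelihood ratio and mutual information -/

/-- Law of the output `Ŝ` of the channel `W` with Bernoulli(`q`) input. -/
noncomputable def outputMass (q : ℝ) (W : Bool → Bool → ℝ) (b : Bool) : ℝ :=
  ∑ a, jointMass q W a b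

/-- Ratio of the joint law of `(S, Ŝ)` to the product of its marginals; its logarithm is the
information density. The first marginal is written `bernoulliMass q a`, which it equals when the
rows of `W` sum to `1`. The value is `0` where a marginal vanishes, and there the joint mass
vanishes too. -/
noncomputable def likelihoodRatio (q : ℝ) (W : Bool → Bool → ℝ) (a b : Bool) : ℝ :=
  jointMass q W a b / (bernoulliMass q a * outputMass q W b)

theorem sum_jointMass (q : ℝ) {W : Bool → Bool → ℝ} (hW1 : ∀ s, ∑ t, W s t = 1) (a : Bool) :
    ∑ b, jointMass q W a b = bernoulliMass q a := by
  simp only [jointMass, ← mul_sum, hW1, mul_one]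

theorem channelInformation_eq (q : ℝ) {W : Bool → Bool → ℝ} (hW1 : ∀ s, ∑ t, W s t = 1) :
    channelInformation q W =
      ∑ a, ∑ b, jointMass q W a b * Real.logb 2 (likelihoodRatio q W a b) := by
  simp only [channelInformation, mutualInformation, sum_jointMass q hW1]
  rfl

theorem sum_outputMass (q : ℝ) {W : Bool → Bool → ℝ} (hW1 : ∀ s, ∑ t, W s t = 1) :
    ∑ b, outputMass q W b = 1 := by
  unfold outputMass
  rw [sum_comm]
  simp only [sum_jointMass q hW1, sum_bernoulliMass]

theorem jointMass_nonneg {q : ℝ} (hq0 : 0 ≤ q) (hq1 : q ≤ 1) {W : Bool → Bool → ℝ}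
    (hW0 : ∀ s t, 0 ≤ W s t) (a b : Bool) : 0 ≤ jointMass q W a b :=
  mul_nonneg (bernoulliMass_nonneg hq0 hq1 a) (hW0 a b)

theorem outputMass_nonneg {q : ℝ} (hq0 : 0 ≤ q) (hq1 : q ≤ 1) {W : Bool → Bool → ℝ}
    (hW0 : ∀ s t, 0 ≤ W s t) (b : Bool) : 0 ≤ outputMass q W b :=
  sum_nonneg fun a _ => jointMass_nonneg hq0 hq1 hW0 a b

theorem jointMass_le_outputMass {q : ℝ} (hq0 : 0 ≤ q) (hq1 : q ≤ 1) {W : Bool → Bool → ℝ}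
    (hW0 : ∀ s t, 0 ≤ W s t) (a b : Bool) : jointMass q W a b ≤ outputMass q W b :=
  single_le_sum (f := fun a => jointMass q W a b)
    (fun a _ => jointMass_nonneg hq0 hq1 hW0 a b) (mem_univ a)

theorem likelihoodRatio_pos {q : ℝ} (hq0 : 0 ≤ q) (hq1 : q ≤ 1) {W : Bool → Bool → ℝ}
    (hW0 : ∀ s t, 0 ≤ W s t) {a b : Bool} (h : 0 < jointMass q W a b) :
    0 < likelihoodRatio q W a b := by
  have ha : 0 < bernoulliMass q a :=
    (bernoulliMass_nonneg hq0 hq1 a).lt_of_ne' fun h0 => by simp [jointMass, h0] at h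
  exact div_pos h (mul_pos ha (h.trans_le (jointMass_le_outputMass hq0 hq1 hW0 a b)))

theorem likelihoodRatio_nonneg {q : ℝ} (hq0 : 0 ≤ q) (hq1 : q ≤ 1) {W : Bool → Bool → ℝ}
    (hW0 : ∀ s t, 0 ≤ W s t) (a b : Bool) : 0 ≤ likelihoodRatio q W a b :=
  div_nonneg (jointMass_nonneg hq0 hq1 hW0 a b)
    (mul_nonneg (bernoulliMass_nonneg hq0 hq1 a) (outputMass_nonneg hq0 hq1 hW0 b))

theorem channelInformation_nonneg {q : ℝ} (hq0 : 0 ≤ q) (hq1 : q ≤ 1) {W : Bool → Bool → ℝ}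
    (hW0 : ∀ s t, 0 ≤ W s t) (hW1 : ∀ s, ∑ t, W s t = 1) : 0 ≤ channelInformation q W := by
  have h2 : 0 < Real.log 2 := Real.log_pos one_lt_two
  have hle : ∀ a b, jointMass q W a b - bernoulliMass q a * outputMass q W b ≤
      jointMass q W a b * Real.logb 2 (likelihoodRatio q W a b) * Real.log 2 := by
    intro a b
    rcases (jointMass_nonneg hq0 hq1 hW0 a b).eq_or_lt with h | h
    · simp [← h, mul_nonneg (bernoulliMass_nonneg hq0 hq1 a) (outputMass_nonneg hq0 hq1 hW0 b)]
    · have hL := likelihoodRatio_pos hq0 hq1 hW0 h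
      have hlog := Real.one_sub_inv_le_log_of_pos hL
      -- `log x ≥ 1 - x⁻¹`, multiplied by the joint mass.
      have : jointMass q W a b * (likelihoodRatio q W a b)⁻¹ =
          bernoulliMass q a * outputMass q W b := by
        rw [likelihoodRatio, inv_div]; field_simp
      rw [Real.logb, mul_assoc, div_mul_cancel₀ _ h2.ne']
      nlinarith [mul_le_mul_of_nonneg_left hlog h.le]
  have hsum := sum_le_sum fun a (_ : a ∈ univ) => sum_le_sum fun b (_ : b ∈ univ) => hle a b
  simp only [← sum_mul, ← channelInformation_eq q hW1, sum_sub_distrib, ← mul_sum,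
    sum_jointMass q hW1, sum_outputMass q hW1, mul_one, sub_self, sum_const_zero] at hsum
  exact nonneg_of_mul_nonneg_left hsum h2

theorem channel_le_rpow_mul_outputMass {q : ℝ} (hq0 : 0 ≤ q) (hq1 : q ≤ 1)
    {W : Bool → Bool → ℝ} (hW0 : ∀ s t, 0 ≤ W s t) {a : Bool} (ha : bernoulliMass q a ≠ 0)
    (b : Bool) :
    W a b ≤ (2 : ℝ) ^ Real.logb 2 (likelihoodRatio q W a b) * outputMass q W b := by
  rcases (hW0 a b).eq_or_lt with h | h
  · rw [← h]
    exact mul_nonneg (by positivity) (outputMass_nonneg hq0 hq1 hW0 b)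
  · have hJ : 0 < jointMass q W a b :=
      mul_pos ((bernoulliMass_nonneg hq0 hq1 a).lt_of_ne' ha) h
    have hQ := hJ.trans_le (jointMass_le_outputMass hq0 hq1 hW0 a b)
    rw [Real.rpow_logb two_pos (by norm_num) (likelihoodRatio_pos hq0 hq1 hW0 hJ),
      likelihoodRatio, jointMass]
    apply le_of_eq
    field_simp

/-- Change of measure: where the information density of a block is at most `r`, passing from the
conditional law to the output law costs a factor of at most `2 ^ r`. -/
theorem rpow_mul_prod_channel_le {q : ℝ} (hq0 : 0 ≤ q) (hq1 : q ≤ 1)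
    {W : Bool → Bool → ℝ} (hW0 : ∀ s t, 0 ≤ W s t) {N : ℕ} {s t : Fin N → Bool} {r : ℝ}
    (hs : sourceMass q s ≠ 0) (hr : ∑ i, Real.logb 2 (likelihoodRatio q W (s i) (t i)) ≤ r) :
    (2 : ℝ) ^ (-r) * ∏ i, W (s i) (t i) ≤ ∏ i, outputMass q W (t i) := by
  have hs' : ∀ i, bernoulliMass q (s i) ≠ 0 := fun i => (prod_ne_zero_iff.1 hs) i (mem_univ i)
  have h1 : ∏ i, W (s i) (t i) ≤ (2 : ℝ) ^ r * ∏ i, outputMass q W (t i) := by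
    calc _ ≤ ∏ i, ((2 : ℝ) ^ Real.logb 2 (likelihoodRatio q W (s i) (t i)) *
          outputMass q W (t i)) := prod_le_prod (fun i _ => hW0 _ _)
            fun i _ => channel_le_rpow_mul_outputMass hq0 hq1 hW0 (hs' i) _
      _ = (2 : ℝ) ^ (∑ i, Real.logb 2 (likelihoodRatio q W (s i) (t i))) *
          ∏ i, outputMass q W (t i) := by
          rw [prod_mul_distrib, ← Real.rpow_sum_of_pos two_pos]
      _ ≤ _ := mul_le_mul_of_nonneg_right (Real.rpow_le_rpow_of_exponent_le one_le_two hr)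
          (prod_nonneg fun i _ => outputMass_nonneg hq0 hq1 hW0 _)
  calc _ ≤ (2 : ℝ) ^ (-r) * ((2 : ℝ) ^ r * ∏ i, outputMass q W (t i)) :=
        mul_le_mul_of_nonneg_left h1 (by positivity)
    _ = _ := by rw [← mul_assoc, ← Real.rpow_add two_pos]; simp

/-! ### Random codes for a channel with slack in all constraints -/

theorem sum_sum_pi_eq_sum_pi_prod {ι α β : Type*} [Fintype ι] [DecidableEq ι] [Fintype α]
    [Fintype β] (F : (ι → α) → (ι → β) → ℝ) :
    ∑ s, ∑ t, F s t = ∑ x : ι → α × β, F (fun i => (x i).1) (fun i => (x i).2) := by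
  rw [← Fintype.sum_prod_type',
    ← (Equiv.arrowProdEquivProdArrow ι (fun _ => α) (fun _ => β)).sum_comp]
  rfl

theorem distortion_nonneg (a b : Bool) : 0 ≤ distortion a b := by
  unfold distortion; split_ifs <;> norm_num

theorem distortion_le_one (a b : Bool) : distortion a b ≤ 1 := by
  unfold distortion; split_ifs <;> norm_num

theorem blockDistortion_le_one {N : ℕ} (s t : Fin N → Bool) : blockDistortion s t ≤ 1 := by
  unfold blockDistortion
  rcases N.eq_zero_or_pos with rfl | hN
  · simp
  have hN' : (0 : ℝ) < N := by exact_mod_cast hN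
  rw [one_div, inv_mul_le_iff₀ hN', mul_one]
  exact (sum_le_sum fun i _ => distortion_le_one (s i) (t i)).trans (by simp)

theorem weight_zero_word {N : ℕ} : weight (fun _ : Fin N => false) = 0 := by
  simp [weight]

theorem tendsto_exp_neg_floor {R R' : ℝ} (h0 : 0 ≤ R') (h : R' < R) :
    Filter.Tendsto (fun N : ℕ => Real.exp (-((⌊(2 : ℝ) ^ ((N : ℝ) * R)⌋₊ : ℝ) *
      (2 : ℝ) ^ (-((N : ℝ) * R'))))) Filter.atTop (nhds 0) := by
  refine Real.tendsto_exp_neg_atTop_nhds_zero.comp ?_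
  have h1 : Filter.Tendsto (fun N : ℕ => ((2 : ℝ) ^ (R - R')) ^ N - 1) Filter.atTop
      Filter.atTop :=
    Filter.tendsto_atTop_add_const_right _ _ (tendsto_pow_atTop_atTop_of_one_lt
      (Real.one_lt_rpow one_lt_two (sub_pos.2 h)))
  refine Filter.tendsto_atTop_mono (fun N => ?_) h1
  have hy : (2 : ℝ) ^ (-((N : ℝ) * R')) ≤ 1 :=
    Real.rpow_le_one_of_one_le_of_nonpos one_le_two (by
      have : 0 ≤ (N : ℝ) * R' := by positivity
      linarith)
  have hy0 : 0 < (2 : ℝ) ^ (-((N : ℝ) * R')) := by positivity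
  have hf := (Nat.lt_floor_add_one ((2 : ℝ) ^ ((N : ℝ) * R))).le
  have hm : ((2 : ℝ) ^ (R - R')) ^ N = (2 : ℝ) ^ ((N : ℝ) * R) * (2 : ℝ) ^ (-((N : ℝ) * R')) := by
    rw [← Real.rpow_natCast, ← Real.rpow_mul two_pos.le, ← Real.rpow_add two_pos]
    congr 1; ring
  rw [hm]
  nlinarith [mul_le_mul_of_nonneg_right hf hy0.le]

/-- Codes from random covering, when `W` satisfies the rate, distortion and weight bounds strictly.
A pair of words is good if its information density, distortion and weight are all below their
bounds. Codewords that are too heavy are replaced by the zero word; no good pair contains one, so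
only source words without a good codeword can have distortion above `D`. -/
theorem eventually_exists_code {q p R D ε : ℝ} (hq0 : 0 ≤ q) (hq1 : q ≤ 1)
    {W : Bool → Bool → ℝ} (hW0 : ∀ s t, 0 ≤ W s t) (hW1 : ∀ s, ∑ t, W s t = 1)
    (hI : channelInformation q W < R)
    (hD : ∑ s, ∑ t, jointMass q W s t * distortion s t < D)
    (hp : ∑ s, jointMass q W s true < p) (hε : 0 < ε) :
    ∀ᶠ N : ℕ in Filter.atTop, ∃ (M : ℕ) (c : SourceCode N M),
      (M : ℝ) ≤ (2 : ℝ) ^ ((N : ℝ) * R) ∧ c.EveryWeightLE p ∧ c.expDistortion q ≤ D + ε := by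
  classical
  obtain ⟨R', hR', hR'R⟩ := exists_between hI
  have hI0 := channelInformation_nonneg hq0 hq1 hW0 hW1
  have hJ0 := jointMass_nonneg hq0 hq1 hW0
  have hp0 : 0 ≤ p := (sum_nonneg fun s _ => hJ0 s true).trans hp.le
  have hD0 : 0 ≤ D := (sum_nonneg fun s _ => sum_nonneg fun t _ =>
    mul_nonneg (hJ0 s t) (distortion_nonneg s t)).trans hD.le
  set μ : Bool × Bool → ℝ := fun x => jointMass q W x.1 x.2 with hμ
  have hμ0 : ∀ x, 0 ≤ μ x := fun x => hJ0 _ _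
  have hμ1 : ∑ x, μ x = 1 := by
    rw [hμ, Fintype.sum_prod_type]
    simp only [sum_jointMass q hW1, sum_bernoulliMass]
  have t1 := tendsto_upper_tail μ (fun x => Real.logb 2 (likelihoodRatio q W x.1 x.2)) R' hμ0 hμ1
    (by rw [Fintype.sum_prod_type, ← channelInformation_eq q hW1]; exact hR')
  have t2 := tendsto_upper_tail μ (fun x => distortion x.1 x.2) D hμ0 hμ1
    (by rw [Fintype.sum_prod_type]; exact hD)
  have t3 := tendsto_upper_tail μ (fun x => if x.2 then (1 : ℝ) else 0) p hμ0 hμ1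
    (by rw [Fintype.sum_prod_type]; simpa [hμ] using hp)
  have t := ((t1.add t2).add t3).add (tendsto_exp_neg_floor (hI0.trans hR'.le) hR'R)
  simp only [add_zero] at t
  filter_upwards [t.eventually_lt_const hε, Filter.eventually_gt_atTop 0] with N hN hN0
  have hNpos : (0 : ℝ) < N := by exact_mod_cast hN0
  obtain ⟨G, hGiff⟩ : ∃ G : (Fin N → Bool) → (Fin N → Bool) → Prop, ∀ s t, G s t ↔
      ∑ i, Real.logb 2 (likelihoodRatio q W (s i) (t i)) < N * R' ∧
      ∑ i, distortion (s i) (t i) < N * D ∧ ∑ i, (if t i then (1 : ℝ) else 0) < N * p :=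
    ⟨_, fun _ _ => Iff.rfl⟩
  set M := ⌊(2 : ℝ) ^ ((N : ℝ) * R)⌋₊ with hM
  obtain ⟨C, hC⟩ := exists_covering (sourceMass q) (fun t : Fin N → Bool => ∏ i, outputMass q W (t i))
    (fun s t => ∏ i, W (s i) (t i)) G ((2 : ℝ) ^ (-((N : ℝ) * R'))) M
    (sourceMass_nonneg hq0 hq1) (sum_sourceMass q N)
    (fun t => prod_nonneg fun i _ => outputMass_nonneg hq0 hq1 hW0 _)
    (by rw [sum_pi_prod (fun (_ : Fin N) b => outputMass q W b)]
        simp only [sum_outputMass q hW1, prod_const_one])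
    (fun s t => prod_nonneg fun i _ => hW0 _ _)
    (fun s => by rw [sum_pi_prod (fun (i : Fin N) b => W (s i) b)]; simp only [hW1, prod_const_one])
    (fun s t hs hG => rpow_mul_prod_channel_le hq0 hq1 hW0 hs ((hGiff s t).1 hG).1.le)
  have hfail : ∑ s, ∑ t, sourceMass q s * (∏ i, W (s i) (t i)) * (if G s t then (0 : ℝ) else 1) ≤
      ∑ x : Fin N → Bool × Bool, (∏ i, μ (x i)) *
        (if N * R' ≤ ∑ i, Real.logb 2 (likelihoodRatio q W (x i).1 (x i).2) then 1 else 0) +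
      ∑ x : Fin N → Bool × Bool, (∏ i, μ (x i)) *
        (if N * D ≤ ∑ i, distortion (x i).1 (x i).2 then 1 else 0) +
      ∑ x : Fin N → Bool × Bool, (∏ i, μ (x i)) *
        (if N * p ≤ ∑ i, (if (x i).2 then (1 : ℝ) else 0) then 1 else 0) := by
    rw [sum_sum_pi_eq_sum_pi_prod, ← sum_add_distrib, ← sum_add_distrib]
    refine sum_le_sum fun x _ => ?_
    rw [sourceMass, ← prod_mul_distrib, ← mul_add, ← mul_add]
    refine mul_le_mul_of_nonneg_left ?_ (prod_nonneg fun i _ => hμ0 _)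
    by_cases h1 : N * R' ≤ ∑ i, Real.logb 2 (likelihoodRatio q W (x i).1 (x i).2)
    · simp only [h1, if_true]
      split_ifs <;> norm_num
    by_cases h2 : N * D ≤ ∑ i, distortion (x i).1 (x i).2
    · simp only [h2, if_true]
      split_ifs <;> norm_num
    by_cases h3 : N * p ≤ ∑ i, (if (x i).2 then (1 : ℝ) else 0)
    · simp only [h3, if_true]
      split_ifs <;> norm_num
    have hG : G (fun i => (x i).1) (fun i => (x i).2) :=
      (hGiff _ _).2 ⟨not_le.1 h1, not_le.1 h2, not_le.1 h3⟩
    rw [if_pos hG, if_neg h1, if_neg h2, if_neg h3]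
    norm_num
  have hMpos : 0 < M := by
    rw [hM, Nat.floor_pos]
    refine Real.one_le_rpow one_le_two ?_
    have : 0 ≤ R := (hI0.trans hI.le)
    positivity
  let c : SourceCode N M :=
    { enc := fun s => if h : ∃ m, G s (C m) then h.choose else ⟨0, hMpos⟩
      dec := fun m => if weight (C m) ≤ p then C m else fun _ => false }
  refine ⟨M, c, Nat.floor_le (by positivity), fun m => ?_, ?_⟩
  · by_cases h : weight (C m) ≤ p
    · simp [c, h]
    · simpa [c, h, weight_zero_word] using hp0
  have hd : ∀ s, blockDistortion s (c.reconstruct s) ≤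
      D + (if ∃ m, G s (C m) then (0 : ℝ) else 1) := by
    intro s
    by_cases h : ∃ m, G s (C m)
    · have hg := (hGiff _ _).1 h.choose_spec
      have hw : weight (C h.choose) ≤ p := by
        rw [weight, one_div, inv_mul_le_iff₀ hNpos]
        exact hg.2.2.le
      have : c.reconstruct s = C h.choose := by
        simp only [SourceCode.reconstruct, c, dif_pos h, if_pos hw]
      rw [this, if_pos h, add_zero, blockDistortion, one_div, inv_mul_le_iff₀ hNpos]
      exact hg.2.1.le
    · rw [if_neg h]
      linarith [blockDistortion_le_one s (c.reconstruct s)]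
  calc c.expDistortion q
      ≤ ∑ s, sourceMass q s * (D + (if ∃ m, G s (C m) then (0 : ℝ) else 1)) :=
        sum_le_sum fun s _ => mul_le_mul_of_nonneg_left (hd s) (sourceMass_nonneg hq0 hq1 s)
    _ = D + ∑ s, sourceMass q s * (if ∃ m, G s (C m) then (0 : ℝ) else 1) := by
        simp only [mul_add, sum_add_distrib, ← sum_mul, sum_sourceMass, one_mul]
    _ ≤ D + ε := by linarith

/-! ### The feasible set is compact and the information is continuous -/

/-- `I(S; Ŝ) = H(S) + H(Ŝ) - H(S, Ŝ)`, which shows continuity where masses vanish. -/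
theorem channelInformation_eq_entropies (q : ℝ) {W : Bool → Bool → ℝ}
    (hq0 : 0 ≤ q) (hq1 : q ≤ 1) (hW0 : ∀ s t, 0 ≤ W s t) (hW1 : ∀ s, ∑ t, W s t = 1) :
    channelInformation q W = (∑ a, Real.negMulLog (bernoulliMass q a) +
      ∑ b, Real.negMulLog (outputMass q W b) -
      ∑ a, ∑ b, Real.negMulLog (jointMass q W a b)) / Real.log 2 := by
  have h : ∀ a b, jointMass q W a b * Real.logb 2 (likelihoodRatio q W a b) =
      (jointMass q W a b * -Real.log (bernoulliMass q a) +
        jointMass q W a b * -Real.log (outputMass q W b) -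
        Real.negMulLog (jointMass q W a b)) / Real.log 2 := by
    intro a b
    rcases (jointMass_nonneg hq0 hq1 hW0 a b).eq_or_lt with h | h
    · simp [← h]
    · have ha : bernoulliMass q a ≠ 0 := fun h0 => by simp [jointMass, h0] at h
      have hb := h.trans_le (jointMass_le_outputMass hq0 hq1 hW0 a b)
      rw [likelihoodRatio, Real.logb, Real.log_div h.ne' (mul_ne_zero ha hb.ne'),
        Real.log_mul ha hb.ne', Real.negMulLog]
      ring
  have e2 : ∑ a, ∑ b, jointMass q W a b * -Real.log (outputMass q W b) =
      ∑ b, Real.negMulLog (outputMass q W b) := by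
    rw [sum_comm]
    refine sum_congr rfl fun b _ => ?_
    rw [← sum_mul, Real.negMulLog, outputMass]; ring
  have e1 : ∑ a, ∑ b, jointMass q W a b * -Real.log (bernoulliMass q a) =
      ∑ a, Real.negMulLog (bernoulliMass q a) := by
    refine sum_congr rfl fun a _ => ?_
    rw [← sum_mul, sum_jointMass q hW1, Real.negMulLog]; ring
  rw [channelInformation_eq q hW1, ← e1, ← e2]
  simp only [h, ← sum_div, sum_sub_distrib, sum_add_distrib]

theorem continuousOn_channelInformation {q : ℝ} (hq0 : 0 ≤ q) (hq1 : q ≤ 1) :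
    ContinuousOn (channelInformation q)
      {W | (∀ s t, 0 ≤ W s t) ∧ ∀ s, ∑ t, W s t = 1} := by
  refine ContinuousOn.congr (Continuous.continuousOn ?_)
    fun W hW => channelInformation_eq_entropies q hq0 hq1 hW.1 hW.2
  have hJ : ∀ a b, Continuous fun W => jointMass q W a b := by
    intro a b
    unfold jointMass
    fun_prop
  have hQ : ∀ b, Continuous fun W => outputMass q W b :=
    fun b => continuous_finsetSum _ fun a _ => hJ a b
  refine Continuous.div_const (Continuous.sub (continuous_const.add ?_) ?_) _
  · exact continuous_finsetSum _ fun b _ => Real.continuous_negMulLog.comp (hQ b)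
  · exact continuous_finsetSum _ fun a _ => continuous_finsetSum _ fun b _ =>
      Real.continuous_negMulLog.comp (hJ a b)

theorem isCompact_feasibleChannels (q p D : ℝ) : IsCompact (feasibleChannels q p D) := by
  have hJ : ∀ a b, Continuous fun W => jointMass q W a b := by
    intro a b
    unfold jointMass
    fun_prop
  refine (isCompact_Icc (a := fun _ _ => (0 : ℝ)) (b := fun _ _ => (1 : ℝ))).of_isClosed_subset
    ?_ ?_
  · have h1 : IsClosed {W : Bool → Bool → ℝ | ∀ s t, 0 ≤ W s t} := by
      simp only [Set.ofPred_forall]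
      exact isClosed_iInter fun s => isClosed_iInter fun t =>
        isClosed_le continuous_const (by fun_prop)
    have h2 : IsClosed {W : Bool → Bool → ℝ | ∀ s, ∑ t, W s t = 1} := by
      simp only [Set.ofPred_forall]
      exact isClosed_iInter fun s => isClosed_eq (by fun_prop) continuous_const
    refine h1.inter (h2.inter (IsClosed.inter ?_ ?_))
    · exact isClosed_le (continuous_finsetSum _ fun a _ => continuous_finsetSum _ fun b _ =>
        (hJ a b).mul continuous_const) continuous_const
    · exact isClosed_le (continuous_finsetSum _ fun a _ => hJ a true) continuous_const
  · rintro W ⟨h0, h1, -⟩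
    refine ⟨fun s t => h0 s t, fun s t => ?_⟩
    rw [← h1 s]
    exact single_le_sum (f := fun t => W s t) (fun t _ => h0 s t) (mem_univ t)

/-- Necessity is `E d(S, Ŝ) = q - P(S = Ŝ = 1) ≥ q - p`. For sufficiency, keep zeros and turn a
one into a zero with the smallest probability allowed by the weight bound. -/
theorem feasibleChannels_nonempty_iff {q p D : ℝ} (hq0 : 0 ≤ q) (hq1 : q ≤ 1) (hp0 : 0 ≤ p) :
    (feasibleChannels q p D).Nonempty ↔ max (q - p) 0 ≤ D := by
  constructor
  · rintro ⟨W, h0, h1, hd, hp⟩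
    refine max_le ?_ ((sum_nonneg fun s _ => sum_nonneg fun t _ =>
      mul_nonneg (jointMass_nonneg hq0 hq1 h0 s t) (distortion_nonneg s t)).trans hd)
    have h1t := h1 true
    simp only [Fintype.sum_bool, jointMass, bernoulliMass, distortion] at h1t hd hp
    simp [show ¬ (true < false) by decide] at hd hp
    nlinarith [mul_nonneg (sub_nonneg.2 hq1) (h0 false true), congrArg (q * ·) h1t]
  · intro h
    have hD0 := (le_max_right _ _).trans h
    have hqp := (le_max_left _ _).trans h
    rcases le_or_gt q p with hle | hlt
    · refine ⟨fun s t => if s = t then 1 else 0, fun s t => ?_, fun s => ?_, ?_, ?_⟩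
      · cases s <;> cases t <;> simp
      · cases s <;> simp
      · simpa [jointMass, bernoulliMass, distortion] using hD0
      · simpa [jointMass, bernoulliMass] using hle
    · have hq : 0 < q := hp0.trans_lt hlt
      have hpq : p / q ≤ 1 := (div_le_one hq).2 hlt.le
      refine ⟨fun s t => if s then (if t then p / q else 1 - p / q) else (if t then 0 else 1),
        fun s t => ?_, fun s => ?_, ?_, ?_⟩
      · have : 0 ≤ p / q := by positivity
        cases s <;> cases t <;> simp [hpq, this]
      · cases s <;> simp
      · simp [jointMass, bernoulliMass, distortion]
        rw [mul_sub, mul_div_cancel₀ _ hq.ne']; linarith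
      · simp [jointMass, bernoulliMass]
        rw [mul_div_cancel₀ _ hq.ne']

/-! ### Achievability -/

/-- For `p > 0`, mixing `W` with the channel whose output is always zero makes the weight bound
strict at an arbitrarily small cost in information and distortion. -/
theorem eventually_exists_code_of_feasible {q p R D ε : ℝ} (hq0 : 0 ≤ q) (hq1 : q ≤ 1)
    (hp0 : 0 < p) {W : Bool → Bool → ℝ} (hW : W ∈ feasibleChannels q p D)
    (hI : channelInformation q W < R) (hε : 0 < ε) :
    ∀ᶠ N : ℕ in Filter.atTop, ∃ (M : ℕ) (c : SourceCode N M),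
      (M : ℝ) ≤ (2 : ℝ) ^ ((N : ℝ) * R) ∧ c.EveryWeightLE p ∧ c.expDistortion q ≤ D + ε := by
  obtain ⟨h0, h1, hd, hp⟩ := hW
  -- The mixture with parameter `δ`, to be taken small and positive.
  let V : ℝ → Bool → Bool → ℝ := fun δ s t => (1 - δ) * W s t + δ * if t then 0 else 1
  have hV : Continuous V := by
    refine continuous_pi fun s => continuous_pi fun t => ?_
    fun_prop
  have hV0 : V 0 = W := by
    funext s t
    simp [V]
  have hVmem : ∀ δ ∈ Set.Ioo (0 : ℝ) 1, (∀ s t, 0 ≤ V δ s t) ∧ ∀ s, ∑ t, V δ s t = 1 := by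
    rintro δ ⟨hδ0, hδ1⟩
    refine ⟨fun s t => add_nonneg (mul_nonneg (by linarith) (h0 s t))
      (mul_nonneg hδ0.le (by split_ifs <;> norm_num)), fun s => ?_⟩
    simp only [V, sum_add_distrib, ← mul_sum, h1]
    simp
  have hIoo : ∀ᶠ δ in nhdsWithin (0 : ℝ) (Set.Ioi 0), δ ∈ Set.Ioo (0 : ℝ) 1 :=
    Ioo_mem_nhdsGT one_pos
  have hW' : Filter.Tendsto V (nhdsWithin (0 : ℝ) (Set.Ioi 0))
      (nhdsWithin W {W | (∀ s t, 0 ≤ W s t) ∧ ∀ s, ∑ t, W s t = 1}) := by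
    refine tendsto_nhdsWithin_iff.2 ⟨?_, hIoo.mono hVmem⟩
    simpa [hV0] using (hV.tendsto 0).mono_left nhdsWithin_le_nhds
  have eI := ((continuousOn_channelInformation hq0 hq1 W ⟨h0, h1⟩).tendsto.comp
    hW').eventually_lt_const hI
  have hdist : Continuous fun δ => ∑ s, ∑ t, jointMass q (V δ) s t * distortion s t := by
    simp only [jointMass, V]
    fun_prop
  have eD := ((hdist.tendsto 0).mono_left (nhdsWithin_le_nhds (s := Set.Ioi 0))).eventually_lt_const
    (show _ < D + ε / 2 by rw [hV0]; linarith)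
  obtain ⟨δ, ⟨hδI, hδD⟩, hδ⟩ := ((eI.and eD).and hIoo).exists
  have hδp : ∑ s, jointMass q (V δ) s true < p := by
    have : ∑ s, jointMass q (V δ) s true = (1 - δ) * ∑ s, jointMass q W s true := by
      rw [mul_sum]
      refine sum_congr rfl fun s _ => ?_
      simp only [jointMass, V, if_true]
      ring
    rw [this]
    nlinarith [hδ.1, hδ.2, mul_le_mul_of_nonneg_left hp (sub_nonneg.2 hδ.2.le)]
  filter_upwards [eventually_exists_code hq0 hq1 (hVmem δ hδ).1 (hVmem δ hδ).2 hδI hδD hδp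
    (half_pos hε)] with N ⟨M, c, hM, hc, hcd⟩
  exact ⟨M, c, hM, hc, by linarith⟩

/-- The code whose only codeword is the zero word. -/
def zeroCode (N : ℕ) : SourceCode N 1 := ⟨fun _ => 0, fun _ _ => false⟩

theorem zeroCode_everyWeightLE {p : ℝ} (hp : 0 ≤ p) (N : ℕ) : (zeroCode N).EveryWeightLE p :=
  fun _ => by simpa [zeroCode, weight_zero_word] using hp

theorem sum_sourceMass_mul_average (q : ℝ) {N : ℕ} (hN : 0 < N) (g : Bool → ℝ) :
    ∑ s : Fin N → Bool, sourceMass q s * ((1 / (N : ℝ)) * ∑ i, g (s i)) =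
      ∑ a, bernoulliMass q a * g a := by
  have hN' : (N : ℝ) ≠ 0 := by exact_mod_cast hN.ne'
  have : ∀ s : Fin N → Bool, sourceMass q s * ((1 / (N : ℝ)) * ∑ i, g (s i)) =
      (1 / (N : ℝ)) * ∑ i, sourceMass q s * g (s i) := by
    intro s
    rw [← mul_sum]; ring
  rw [sum_congr rfl fun s _ => this s, ← mul_sum, sum_comm]
  simp only [sum_sourceMass_coord, sum_const, card_univ, Fintype.card_fin, nsmul_eq_mul]
  field_simp

theorem expDistortion_zeroCode (q : ℝ) {N : ℕ} (hN : 0 < N) :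
    (zeroCode N).expDistortion q = q := by
  have := sum_sourceMass_mul_average q hN (fun a => distortion a false)
  exact this.trans (by simp [bernoulliMass, distortion])

/-- Every rate above the information of a feasible channel is achievable. One sequence of codes must
serve every `ε`, so a nearly optimal code is taken at each block length. For `p = 0` no strict
weight bound is possible, but feasibility then forces `q ≤ D` and the zero code suffices. -/
theorem achievable_of_feasible {q p R D : ℝ} (hq0 : 0 ≤ q) (hq1 : q ≤ 1) (hp0 : 0 ≤ p)
    {W : Bool → Bool → ℝ} (hW : W ∈ feasibleChannels q p D) (hI : channelInformation q W < R) :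
    Achievable q (fun c => c.EveryWeightLE p) R D := by
  have hR : 0 ≤ R := (channelInformation_nonneg hq0 hq1 hW.1 hW.2.1).trans hI.le
  have hone : ∀ N : ℕ, ((1 : ℕ) : ℝ) ≤ (2 : ℝ) ^ ((N : ℝ) * R) := fun N => by
    rw [Nat.cast_one]
    exact Real.one_le_rpow one_le_two (by positivity)
  rcases hp0.eq_or_lt with rfl | hp
  · have hqD : q ≤ D := by
      have := (feasibleChannels_nonempty_iff hq0 hq1 le_rfl).1 ⟨W, hW⟩
      simpa using (le_max_left _ _).trans this
    refine ⟨fun _ => 1, zeroCode, hone, zeroCode_everyWeightLE le_rfl, fun ε hε => ?_⟩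
    filter_upwards [Filter.eventually_gt_atTop 0] with N hN
    rw [expDistortion_zeroCode q hN]
    linarith
  · let A : ℕ → Set ℝ := fun N => {d | ∃ (M : ℕ) (c : SourceCode N M),
      (M : ℝ) ≤ (2 : ℝ) ^ ((N : ℝ) * R) ∧ c.EveryWeightLE p ∧ c.expDistortion q = d}
    have hAne : ∀ N, (A N).Nonempty := fun N =>
      ⟨_, 1, zeroCode N, hone N, zeroCode_everyWeightLE hp0 N, rfl⟩
    have hAbdd : ∀ N, BddBelow (A N) := fun N => by
      refine ⟨0, ?_⟩
      rintro _ ⟨M, c, -, -, rfl⟩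
      exact sum_nonneg fun s _ => mul_nonneg (sourceMass_nonneg hq0 hq1 s)
        (mul_nonneg (by positivity) (sum_nonneg fun i _ => distortion_nonneg _ _))
    have hch : ∀ N : ℕ, ∃ (M : ℕ) (c : SourceCode N M), (M : ℝ) ≤ (2 : ℝ) ^ ((N : ℝ) * R) ∧
        c.EveryWeightLE p ∧ c.expDistortion q < sInf (A N) + 1 / ((N : ℝ) + 1) := by
      intro N
      obtain ⟨_, ⟨M, c, hM, hc, rfl⟩, hlt⟩ := exists_lt_of_csInf_lt (hAne N)
        (lt_add_of_pos_right (sInf (A N)) (Nat.one_div_pos_of_nat (n := N) (α := ℝ)))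
      exact ⟨M, c, hM, hc, hlt⟩
    choose M c hM hc hlt using hch
    refine ⟨M, c, hM, hc, fun ε hε => ?_⟩
    filter_upwards [eventually_exists_code_of_feasible hq0 hq1 hp hW hI (half_pos hε),
      tendsto_one_div_add_atTop_nhds_zero_nat.eventually_lt_const (half_pos hε)]
      with N ⟨M', c', hM', hc', hd'⟩ hN
    have := csInf_le (hAbdd N) ⟨M', c', hM', hc', rfl⟩
    linarith [hlt N]

/-! ### Converse -/

theorem averageWeightLE_of_everyWeightLE {q p : ℝ} (hq0 : 0 ≤ q) (hq1 : q ≤ 1) {N M : ℕ}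
    {c : SourceCode N M} (hc : c.EveryWeightLE p) : c.AverageWeightLE q p := by
  calc c.expWeight q ≤ ∑ s : Fin N → Bool, sourceMass q s * p :=
        sum_le_sum fun s _ => mul_le_mul_of_nonneg_left (hc _) (sourceMass_nonneg hq0 hq1 s)
    _ = p := by rw [← sum_mul, sum_sourceMass, one_mul]

/-- Joint law of `(S_I, Ŝ_I)`, for a coordinate `I` chosen uniformly and independently of `S`. -/
noncomputable def averageJointMass (q : ℝ) {N M : ℕ} (c : SourceCode N M) (a b : Bool) : ℝ :=
  ∑ s, sourceMass q s * ((1 / (N : ℝ)) * ∑ i, if s i = a ∧ c.reconstruct s i = b then 1 else 0)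

/-- Conditional law of `Ŝ_I` given `S_I`, for a uniformly chosen coordinate `I`. Given an input of
mass zero, the output is put to `0`. -/
noncomputable def averageChannel (q : ℝ) {N M : ℕ} (c : SourceCode N M) (a b : Bool) : ℝ :=
  if bernoulliMass q a = 0 then (if b then 0 else 1)
    else averageJointMass q c a b / bernoulliMass q a

/-- Expectations under the averaged joint law are expected block averages. -/
theorem sum_averageJointMass_mul (q : ℝ) {N M : ℕ} (c : SourceCode N M) (g : Bool → Bool → ℝ) :
    ∑ a, ∑ b, averageJointMass q c a b * g a b =
      ∑ s, sourceMass q s * ((1 / (N : ℝ)) * ∑ i, g (s i) (c.reconstruct s i)) := by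
  have h : ∀ x y : Bool, g x y = ∑ a, ∑ b, (if x = a ∧ y = b then 1 else 0) * g a b := by
    intro x y
    cases x <;> cases y <;> simp
  simp only [averageJointMass, sum_mul]
  simp only [sum_comm (s := (univ : Finset Bool)) (t := (univ : Finset (Fin N → Bool)))]
  refine sum_congr rfl fun s _ => ?_
  simp_rw [fun i => h (s i) (c.reconstruct s i)]
  simp only [sum_comm (s := (univ : Finset (Fin N))) (t := (univ : Finset Bool)), mul_sum, sum_mul]
  refine sum_congr rfl fun a _ => sum_congr rfl fun b _ => sum_congr rfl fun i _ => ?_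
  ring

theorem sum_averageJointMass (q : ℝ) {N M : ℕ} (hN : 0 < N) (c : SourceCode N M) (a : Bool) :
    ∑ b, averageJointMass q c a b = bernoulliMass q a := by
  have h1 := sum_averageJointMass_mul q c (fun x _ => if x = a then 1 else 0)
  rw [sum_sourceMass_mul_average q hN (fun x => if x = a then (1 : ℝ) else 0)] at h1
  simpa [sum_comm (s := (univ : Finset Bool)) (t := (univ : Finset Bool)), ← sum_mul] using h1

theorem averageJointMass_nonneg {q : ℝ} (hq0 : 0 ≤ q) (hq1 : q ≤ 1) {N M : ℕ}
    (c : SourceCode N M) (a b : Bool) : 0 ≤ averageJointMass q c a b :=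
  sum_nonneg fun s _ => mul_nonneg (sourceMass_nonneg hq0 hq1 s)
    (mul_nonneg (by positivity) (sum_nonneg fun i _ => by split_ifs <;> norm_num))

theorem jointMass_averageChannel {q : ℝ} (hq0 : 0 ≤ q) (hq1 : q ≤ 1) {N M : ℕ} (hN : 0 < N)
    (c : SourceCode N M) (a b : Bool) :
    jointMass q (averageChannel q c) a b = averageJointMass q c a b := by
  unfold jointMass averageChannel
  split_ifs with h h'
  · have := (sum_eq_zero_iff_of_nonneg fun b _ => averageJointMass_nonneg hq0 hq1 c a b).1
      ((sum_averageJointMass q hN c a).trans h) b (mem_univ b)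
    rw [h, this, zero_mul]
  · have := (sum_eq_zero_iff_of_nonneg fun b _ => averageJointMass_nonneg hq0 hq1 c a b).1
      ((sum_averageJointMass q hN c a).trans h) b (mem_univ b)
    rw [h, this, zero_mul]
  · field_simp

theorem averageChannel_mem {q p D : ℝ} (hq0 : 0 ≤ q) (hq1 : q ≤ 1) {N M : ℕ} (hN : 0 < N)
    {c : SourceCode N M} (hc : c.AverageWeightLE q p) (hd : c.expDistortion q ≤ D) :
    averageChannel q c ∈ feasibleChannels q p D := by
  refine ⟨fun a b => ?_, fun a => ?_, ?_, ?_⟩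
  · unfold averageChannel
    split_ifs
    · exact le_rfl
    · exact zero_le_one
    · exact div_nonneg (averageJointMass_nonneg hq0 hq1 c a b) (bernoulliMass_nonneg hq0 hq1 a)
  · by_cases h : bernoulliMass q a = 0
    · simp [averageChannel, h]
    · simp only [averageChannel, h, if_false, ← sum_div, sum_averageJointMass q hN c a]
      exact div_self h
  · simp only [jointMass_averageChannel hq0 hq1 hN]
    rw [sum_averageJointMass_mul]
    exact hd
  · simp only [jointMass_averageChannel hq0 hq1 hN]
    have := sum_averageJointMass_mul q c (fun _ b => if b then 1 else 0)
    simp only [Fintype.sum_bool (fun b => averageJointMass q c _ b * _)] at this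
    simp only [if_true, mul_one, Bool.false_eq_true, if_false, mul_zero, add_zero] at this
    rw [this]
    exact hc

theorem sum_bernoulliMass_mul_likelihoodRatio_le_one (q : ℝ) (W : Bool → Bool → ℝ) (b : Bool) :
    ∑ a, bernoulliMass q a * likelihoodRatio q W a b ≤ 1 := by
  calc _ ≤ ∑ a, jointMass q W a b / outputMass q W b := by
        refine sum_le_sum fun a _ => ?_
        rcases eq_or_ne (bernoulliMass q a) 0 with h | h
        · simp [h, jointMass]
        · rw [likelihoodRatio, ← mul_div_assoc, mul_div_mul_left _ _ h]
    _ = outputMass q W b / outputMass q W b := by rw [← sum_div, outputMass]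
    _ ≤ 1 := div_self_le_one _

/-- Converse at a fixed block length. `N` times the information of the averaged channel is the
expectation of `log ∏ r (S_i, Ŝ_i)`, with `r` its likelihood ratio. As `log (x / M) ≤ x / M - 1`, it
is enough that `∏ r (S_i, Ŝ_i)` has expectation at most `M`. This holds since for each fixed
codeword `t` the expectation of `∏ r (S_i, t_i)` factorizes into numbers that are at most `1`. -/
theorem channelInformation_averageChannel_le {q : ℝ} (hq0 : 0 ≤ q) (hq1 : q ≤ 1) {N M : ℕ}
    (hN : 0 < N) (c : SourceCode N M) :
    channelInformation q (averageChannel q c) ≤ Real.logb 2 M / N := by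
  have hNpos : (0 : ℝ) < N := by exact_mod_cast hN
  have hMpos : (0 : ℝ) < M := by exact_mod_cast Fin.pos (c.enc fun _ => false)
  have hl2 : 0 < Real.log 2 := Real.log_pos one_lt_two
  obtain ⟨hW0, hW1, -⟩ := averageChannel_mem hq0 hq1 hN (c := c) (le_refl (c.expWeight q)) le_rfl
  set W := averageChannel q c with hW
  have hr0 : ∀ a b, 0 ≤ likelihoodRatio q W a b := likelihoodRatio_nonneg hq0 hq1 hW0
  have hrpos : ∀ s : Fin N → Bool, sourceMass q s ≠ 0 → ∀ i,
      0 < likelihoodRatio q W (s i) (c.reconstruct s i) := by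
    intro s hs i
    refine likelihoodRatio_pos hq0 hq1 hW0 ?_
    rw [hW, jointMass_averageChannel hq0 hq1 hN]
    refine sum_pos' (fun s' _ => mul_nonneg (sourceMass_nonneg hq0 hq1 s')
      (mul_nonneg (by positivity) (sum_nonneg fun i _ => by split_ifs <;> norm_num)))
      ⟨s, mem_univ s, mul_pos ((sourceMass_nonneg hq0 hq1 s).lt_of_ne' hs)
        (mul_pos (by positivity) ?_)⟩
    exact sum_pos' (fun i _ => by split_ifs <;> norm_num) ⟨i, mem_univ i, by simp⟩
  have hsum : ∑ s, sourceMass q s * ∏ i, likelihoodRatio q W (s i) (c.reconstruct s i) ≤ M := by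
    calc _ ≤ ∑ s, ∑ m, sourceMass q s * ∏ i, likelihoodRatio q W (s i) (c.dec m i) := by
          refine sum_le_sum fun s _ => ?_
          exact single_le_sum
            (f := fun m => sourceMass q s * ∏ i, likelihoodRatio q W (s i) (c.dec m i))
            (fun m _ => mul_nonneg (sourceMass_nonneg hq0 hq1 s)
              (prod_nonneg fun i _ => hr0 _ _)) (mem_univ (c.enc s))
      _ = ∑ m, ∏ i, ∑ a, bernoulliMass q a * likelihoodRatio q W a (c.dec m i) := by
          rw [sum_comm]
          refine sum_congr rfl fun m _ => ?_
          rw [← sum_pi_prod (fun i a => bernoulliMass q a * likelihoodRatio q W a (c.dec m i))]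
          exact sum_congr rfl fun s _ => by rw [sourceMass, ← prod_mul_distrib]
      _ ≤ ∑ m : Fin M, (1 : ℝ) := by
          refine sum_le_sum fun m _ => prod_le_one (fun i _ => sum_nonneg fun a _ =>
            mul_nonneg (bernoulliMass_nonneg hq0 hq1 a) (hr0 _ _)) fun i _ =>
              sum_bernoulliMass_mul_likelihoodRatio_le_one q W _
      _ = M := by simp
  have hlog : ∀ s, sourceMass q s * ∑ i, Real.log (likelihoodRatio q W (s i) (c.reconstruct s i)) ≤
      sourceMass q s * Real.log M +
        ((sourceMass q s * ∏ i, likelihoodRatio q W (s i) (c.reconstruct s i)) / M -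
          sourceMass q s) := by
    intro s
    rcases (sourceMass_nonneg hq0 hq1 s).eq_or_lt with h | h
    · simp [← h]
    have hp := hrpos s h.ne'
    have hP : 0 < ∏ i, likelihoodRatio q W (s i) (c.reconstruct s i) := prod_pos fun i _ => hp i
    have h1 := Real.log_le_sub_one_of_pos (div_pos hP hMpos)
    rw [Real.log_div hP.ne' hMpos.ne', Real.log_prod fun i _ => (hp i).ne'] at h1
    have h2 := mul_le_mul_of_nonneg_left h1 h.le
    rw [mul_div_assoc]
    linarith
  have hI : channelInformation q W = (∑ s, sourceMass q s *
      ∑ i, Real.log (likelihoodRatio q W (s i) (c.reconstruct s i))) / Real.log 2 / N := by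
    rw [channelInformation_eq q hW1]
    simp only [hW, jointMass_averageChannel hq0 hq1 hN]
    rw [sum_averageJointMass_mul, sum_div, sum_div]
    refine sum_congr rfl fun s _ => ?_
    simp only [Real.logb, ← sum_div]
    ring
  have htot := sum_le_sum fun s (_ : s ∈ univ) => hlog s
  rw [sum_add_distrib, sum_sub_distrib, ← sum_mul, ← sum_div, sum_sourceMass, one_mul] at htot
  have : (∑ s, sourceMass q s * ∏ i, likelihoodRatio q W (s i) (c.reconstruct s i)) / M ≤ 1 :=
    (div_le_one hMpos).2 hsum
  rw [hI, Real.logb]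
  gcongr
  linarith

/-! ### Comparison of the operational rates with the single-letter rate -/

theorem singleLetterRate_le {q p D : ℝ} {W : Bool → Bool → ℝ}
    (hW : W ∈ feasibleChannels q p D) :
    singleLetterRate q p D ≤ (channelInformation q W : EReal) :=
  sInf_le ⟨W, hW, rfl⟩

/-- Achievability only bounds the distortion by `D + ε`, so the converse yields a channel for each
`D + 1 / (n + 1)`. The sets of such channels are compact and decreasing, and any common point is
feasible for `D`. -/
theorem exists_feasible_of_achievable {q p R D : ℝ} (hq0 : 0 ≤ q) (hq1 : q ≤ 1)
    (h : Achievable q (fun c => c.AverageWeightLE q p) R D) :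
    ∃ W ∈ feasibleChannels q p D, channelInformation q W ≤ R := by
  obtain ⟨M, c, hM, hc, hlim⟩ := h
  let K : ℕ → Set (Bool → Bool → ℝ) := fun n =>
    feasibleChannels q p (D + 1 / ((n : ℝ) + 1)) ∩ channelInformation q ⁻¹' Set.Iic R
  have hKclosed : ∀ n, IsClosed (K n) := fun n =>
    ((continuousOn_channelInformation hq0 hq1).mono
      fun W hW => ⟨hW.1, hW.2.1⟩).preimage_isClosed_of_isClosed
        (isCompact_feasibleChannels q p _).isClosed isClosed_Iic
  have hKne : ∀ n, (K n).Nonempty := by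
    intro n
    obtain ⟨N, hN, hN0⟩ := ((hlim _ (Nat.one_div_pos_of_nat (n := n))).and
      (Filter.eventually_gt_atTop 0)).exists
    have hNpos : (0 : ℝ) < N := by exact_mod_cast hN0
    have hMpos : (0 : ℝ) < M N := by exact_mod_cast Fin.pos ((c N).enc fun _ => false)
    refine ⟨averageChannel q (c N), averageChannel_mem hq0 hq1 hN0 (hc N) hN,
      (channelInformation_averageChannel_le hq0 hq1 hN0 (c N)).trans ?_⟩
    rw [div_le_iff₀ hNpos, Real.logb_le_iff_le_rpow one_lt_two hMpos, mul_comm]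
    exact hM N
  have hKanti : ∀ n, K (n + 1) ⊆ K n := by
    rintro n W ⟨⟨h0, h1, h2, h3⟩, hI⟩
    refine ⟨⟨h0, h1, h2.trans ?_, h3⟩, hI⟩
    exact add_le_add_right (Nat.one_div_le_one_div n.le_succ) D
  obtain ⟨W, hW⟩ := IsCompact.nonempty_iInter_of_sequence_nonempty_isCompact_isClosed K hKanti hKne
    ((isCompact_feasibleChannels q p _).of_isClosed_subset (hKclosed 0) Set.inter_subset_left)
    hKclosed
  rw [Set.mem_iInter] at hW
  refine ⟨W, ⟨(hW 0).1.1, (hW 0).1.2.1, ?_, (hW 0).1.2.2.2⟩, (hW 0).2⟩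
  have := tendsto_one_div_add_atTop_nhds_zero_nat (𝕜 := ℝ).const_add D
  rw [add_zero] at this
  exact ge_of_tendsto' this fun n => (hW n).1.2.2.1

theorem theorem1 (q p D : ℝ) (hq0 : 0 ≤ q) (hq1 : q ≤ 1) (hp0 : 0 ≤ p) (hp1 : p ≤ 1) :
    rateDistortion q p D = singleLetterRate q p D ∧
    rateDistortionAvg q p D = singleLetterRate q p D ∧
    ((feasibleChannels q p D).Nonempty ↔ max (q - p) 0 ≤ D) ∧
    (max (q - p) 0 ≤ D →
      ∃ W ∈ feasibleChannels q p D,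
        (∀ W' ∈ feasibleChannels q p D, channelInformation q W ≤ channelInformation q W') ∧
        singleLetterRate q p D = (channelInformation q W : EReal)) ∧
    (∀ (N M : ℕ) (c : SourceCode N M), 0 < N → c.AverageWeightLE q p →
      c.expDistortion q ≤ D →
        singleLetterRate q p D ≤ ((Real.logb 2 (M : ℝ) / (N : ℝ) : ℝ) : EReal)) := by
  have hdirect : rateDistortion q p D ≤ singleLetterRate q p D := by
    refine le_sInf ?_
    rintro _ ⟨W, hW, rfl⟩
    refine EReal.le_of_forall_lt_iff_le.1 fun R hR => sInf_le ⟨R, ?_, rfl⟩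
    exact achievable_of_feasible hq0 hq1 hp0 hW (EReal.coe_lt_coe_iff.1 hR)
  have hmono : rateDistortionAvg q p D ≤ rateDistortion q p D := by
    refine sInf_le_sInf ?_
    rintro _ ⟨R, ⟨M, c, hM, hc, hlim⟩, rfl⟩
    exact ⟨R, ⟨M, c, hM, fun N => averageWeightLE_of_everyWeightLE hq0 hq1 (hc N), hlim⟩, rfl⟩
  have hconv : singleLetterRate q p D ≤ rateDistortionAvg q p D := by
    refine le_sInf ?_
    rintro _ ⟨R, hR, rfl⟩
    obtain ⟨W, hW, hI⟩ := exists_feasible_of_achievable hq0 hq1 hR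
    exact (singleLetterRate_le hW).trans (EReal.coe_le_coe_iff.2 hI)
  refine ⟨hdirect.antisymm (hconv.trans hmono), (hmono.trans hdirect).antisymm hconv,
    feasibleChannels_nonempty_iff hq0 hq1 hp0, fun hD => ?_, fun N M c hN hc hd => ?_⟩
  · obtain ⟨W, hW, hmin⟩ := (isCompact_feasibleChannels q p D).exists_isMinOn
      ((feasibleChannels_nonempty_iff hq0 hq1 hp0).2 hD)
      ((continuousOn_channelInformation hq0 hq1).mono fun W hW => ⟨hW.1, hW.2.1⟩)
    refine ⟨W, hW, fun W' hW' => hmin hW', le_antisymm (singleLetterRate_le hW) (le_sInf ?_)⟩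
    rintro _ ⟨W', hW', rfl⟩
    exact EReal.coe_le_coe_iff.2 (hmin hW')
  · exact (singleLetterRate_le (averageChannel_mem hq0 hq1 hN hc hd)).trans
      (EReal.coe_le_coe_iff.2 (channelInformation_averageChannel_le hq0 hq1 hN c))
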